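/- Let $I$ be a finite set, $\Lambda=(\lambda_{ij})_{i,j\in I}$ a rate transition matrix ($\lambda_{ij}\ge 0$ for $i\ne j$, $\sum_j\lambda_{ij}=0$), and $h:I\to O$ a surjection onto a finite set. Let $\Delta$ be the set of probabilities on $I$ (row vectors), $\Delta_a$ ($a\in O$) the set of those supported in $h^{-1}(a)$, and $\Delta_e=\bigcup_{a\in O}\Delta_a$. For each $a\in O$ fix an arbitrary $\nu_a\in\Delta_a$, and for $v\in\mathbb R^I$ let $H_a[v](i)=0$ if $h(i)\ne a$, and for $h(i)=a$ let $H_a[v](i)=v(i)/\sum_{j\in h^{-1}(a)}v(j)$ if the denominator is nonzero and $H_a[v](i)=\nu_a(i)$ otherwise. Let $\phi$ be the flow on $\Delta_e$ such that for $x\in\Delta_a$, $y(t)=\phi(t,x)$ is the unique solution of $y'=1_{h^{-1}(a)}*(y\Lambda)-(y\Lambda 1_{h^{-1}(a)})\,y$, $y(0)=x$, where $*$ is the pointwise product; it satisfies $y(t)\in\Delta_a$ for all $t\ge 0$. Let $\Omega$ be the space of cadlag functions $\omega:[0,\infty)\to I$ with coordinate process $X_t(\omega)=\omega(t)$, $\mathcal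 F^0_t=\sigma(X_s:s\le t)$ and $\mathcal F^0=\sigma(X_s:s\ge0)$. For $\mu\in\Delta$ let $P_\mu$ be the unique probability on $(\Omega,\mathcal F^0)$ with $P_\mu(X_0=i)=\mu(i)$ for $i\in I$ and $E_\mu[f(X_{t+s})\mid\mathcal F^0_t]=(e^{s\Lambda}f)(X_t)$ $P_\mu$-a.s. for all $s,t\ge0$ and $f:I\to\mathbb R$. Let $Y_t=h(X_t)$, let $T_0=0$, and let $T_1<T_2<\cdots$ be the jump times of $Y$ (with $T_n=\infty$ if $Y$ has fewer than $n$ jumps). For $\mu\in\Delta$ the filtering process $\Pi^\mu$ is defined by $\Pi^\mu_0=H_{Y_0}[\mu]$, $\Pi^\mu_t=\phi(t-T_n,\Pi^\mu_{T_n})$ for $T_n\le t<T_{n+1}$, and $\Pi^\mu_{T_{n+1}}=H_{Y_{T_{n+1}}}[\phi(T_{n+1}-T_n,\Pi^\mu_{T_n})\Lambda]$ if $T_{n+1}<\infty$ ($n\ge0$). Let $\bar\Omega$ be the space of cadlag functions $[0,\infty)\to\Delta_e$ with the $\sigma$-algebra $\bar{\mathcal F}^0$ generated by its coordinate maps. For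 $\nu\in\Delta_e$ let $\bar P_\nu$ be the law on $(\bar\Omega,\bar{\mathcal F}^0)$ of $\Pi^\nu$ under $P_\nu$, and for a Borel probability measure $Q$ on $\Delta_e$ let $\bar P_Q(\Gamma)=\int_{\Delta_e}\bar P_\nu(\Gamma)\,Q(d\nu)$, $\Gamma\in\bar{\mathcal F}^0$. Then for every $\mu\in\Delta$ the map $\omega\mapsto\Pi^\mu_\cdot(\omega)$ is measurable from $(\Omega,\mathcal F^0)$ to $(\bar\Omega,\bar{\mathcal F}^0)$, and the law of $\Pi^\mu$ under $P_\mu$ is $\bar P_Q$, where $Q=\sum_{a\in O}\mu(h^{-1}(a))\,\delta_{H_a[\mu]}$ is the Borel probability measure on $\Delta_e$ concentrated at the points $H_a[\mu]$, $a\in O$, with $Q(\{H_a[\mu]\})=\mu(h^{-1}(a))$ for every $a\in O$. -/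

import Mathlib

open MeasureTheory Filter Topology Set
open scoped NNReal ENNReal Matrix

/-! ### Cadlag paths -/

/-- `f` is right-continuous on `[0,∞)` and has (finite) left limits on `(0,∞)`. -/
def IsCadlag {E : Type*} [TopologicalSpace E] (f : ℝ≥0 → E) : Prop :=
  (∀ t, ContinuousWithinAt f (Set.Ici t) t) ∧ ∀ t, 0 < t → ∃ l, Tendsto f (𝓝[<] t) (𝓝 l)

/-- The space of cadlag functions `[0,∞) → E`. -/
def CadlagPath (E : Type*) [TopologicalSpace E] : Type _ := {f : ℝ≥0 → E // IsCadlag f}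

namespace CadlagPath

instance {E : Type*} [TopologicalSpace E] : CoeFun (CadlagPath E) (fun _ => ℝ≥0 → E) :=
  ⟨Subtype.val⟩

/-- The `σ`-algebra generated by all coordinate maps `ω ↦ ω t`, `t ≥ 0`. -/
instance {E : Type*} [TopologicalSpace E] [MeasurableSpace E] : MeasurableSpace (CadlagPath E) :=
  ⨆ t : ℝ≥0, MeasurableSpace.comap (fun ω : CadlagPath E => ω t) inferInstance

/-- The `σ`-algebra generated by the coordinate maps `ω ↦ ω s`, `0 ≤ s ≤ t`. -/
@[reducible] def natFiltration {E : Type*} [TopologicalSpace E] [MeasurableSpace E] (t : ℝ≥0) :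
    MeasurableSpace (CadlagPath E) :=
  ⨆ s : Set.Iic t, MeasurableSpace.comap (fun ω : CadlagPath E => ω (s : ℝ≥0)) inferInstance

theorem eventually_right {I : Type*} [TopologicalSpace I] [DiscreteTopology I]
    (ω : CadlagPath I) (t : ℝ≥0) :
    ∀ᶠ s in 𝓝[≥] t, ω s = ω t :=
  (ω.2.1 t).eventually (p := fun i => i = ω t) (by simp [nhds_discrete])

theorem eventually_left {I : Type*} [TopologicalSpace I] [DiscreteTopology I]
    (ω : CadlagPath I) {t : ℝ≥0} (ht : 0 < t) :
    ∃ i, ∀ᶠ s in 𝓝[<] t, ω s = i := by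
  obtain ⟨i, hi⟩ := ω.2.2 t ht
  exact ⟨i, hi.eventually (p := fun j => j = i) (by simp [nhds_discrete])⟩

end CadlagPath

/-! ### The data -/

/-- The data of the filtering problem: a rate transition matrix `rate` on the state space `I`, a
surjective observation function `obs : I → O`, and arbitrary fixed probabilities `ref a` on `I`
supported in `obs ⁻¹ {a}` (only used to give a value to conditional probabilities given a null
event). -/
structure FilteringModel (I O : Type*) [Fintype I] where
  /-- the rate transition matrix -/
  rate : Matrix I I ℝ
  rate_nonneg : ∀ i j, i ≠ j → 0 ≤ rate i j
  rate_sum : ∀ i, ∑ j, rate i j = 0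
  /-- the observation function -/
  obs : I → O
  obs_surjective : Function.Surjective obs
  /-- the reference probabilities -/
  ref : O → I → ℝ
  ref_mem : ∀ a, ref a ∈ stdSimplex ℝ I
  ref_support : ∀ a i, obs i ≠ a → ref a i = 0

namespace FilteringModel

section Simplex

variable {I O : Type*} [Fintype I] (M : FilteringModel I O)

/-- The face of the simplex of the probabilities supported in `obs ⁻¹ {a}`. -/
def face (a : O) : Set (I → ℝ) := {x | x ∈ stdSimplex ℝ I ∧ ∀ i, M.obs i ≠ a → x i = 0}

/-- The effective simplex: the union of the faces. -/
def effSimplex : Set (I → ℝ) := ⋃ a, M.face a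

/-- An element of the effective simplex, seen as a probability on `I`. -/
def effToSimplex (x : M.effSimplex) : stdSimplex ℝ I :=
  ⟨x.1, by obtain ⟨a, ha⟩ := Set.mem_iUnion.1 x.2; exact ha.1⟩

variable [DecidableEq O]

/-- The vector field `F_a(y) = 1_{h⁻¹(a)} * (yΛ) - (yΛ 1_{h⁻¹(a)}) y`. -/
def vectorField (a : O) (y : I → ℝ) : I → ℝ := fun i =>
  (if M.obs i = a then (y ᵥ* M.rate) i else 0)
    - (∑ j with M.obs j = a, (y ᵥ* M.rate) j) * y i

/-- `y` solves `y'(t) = F_a(y(t))`, `t ≥ 0`, with `y(0) = x` (only the values of `y` on `[0,∞)`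
are relevant). -/
def IsFlowLine (a : O) (x : I → ℝ) (y : ℝ → I → ℝ) : Prop :=
  y 0 = x ∧ ∀ t, 0 ≤ t → HasDerivWithinAt y (M.vectorField a (y t)) (Set.Ici 0) t

/-- The operator `H_a`. -/
noncomputable def H (a : O) (v : I → ℝ) : I → ℝ := fun i =>
  if M.obs i ≠ a then 0
  else if ∑ j with M.obs j = a, v j ≠ 0 then v i / ∑ j with M.obs j = a, v j
  else M.ref a i

end Simplex

/-! #### Existence of the flow and invariance of the faces -/

section Flow

variable {I O : Type*} [Fintype I] (M : FilteringModel I O)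

theorem mul_entry_nonneg (A B : Matrix I I ℝ) (hA : ∀ i j, 0 ≤ A i j) (hB : ∀ i j, 0 ≤ B i j)
    (i j : I) : 0 ≤ (A * B) i j := by
  rw [Matrix.mul_apply]
  exact Finset.sum_nonneg fun k _ => mul_nonneg (hA i k) (hB k j)

theorem hasDerivAt_vecMul_exp [DecidableEq I] (A : Matrix I I ℝ) (x : I → ℝ) (t : ℝ) :
    HasDerivAt (fun s : ℝ => x ᵥ* NormedSpace.exp (s • A))
      ((x ᵥ* NormedSpace.exp (t • A)) ᵥ* A) t := by
  open scoped Matrix.Norms.Operator in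
  have h := hasDerivAt_exp_smul_const A t
  rw [Matrix.vecMul_vecMul]
  exact (LinearMap.toContinuousLinearMap
    (Matrix.vecMulBilin ℝ ℝ x : Matrix I I ℝ →ₗ[ℝ] (I → ℝ))).hasFDerivAt.comp_hasDerivAt t h

theorem exp_entry_nonneg_of_nonneg [DecidableEq I] (A : Matrix I I ℝ) (hA : ∀ i j, 0 ≤ A i j) (i j : I) :
    0 ≤ NormedSpace.exp A i j := by
  open scoped Matrix.Norms.Operator in
  have h := NormedSpace.exp_series_hasSum_exp' (𝕂 := ℝ) A
  have hp : ∀ (n : ℕ) (i j : I), 0 ≤ (A ^ n) i j := by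
    intro n
    induction n with
    | zero =>
      intro i j
      rw [pow_zero, Matrix.one_apply]
      split_ifs <;> norm_num
    | succ n ih =>
      intro i j
      rw [pow_succ]
      exact mul_entry_nonneg _ _ ih hA i j
  have hij : HasSum (fun n : ℕ => ((n.factorial : ℝ)⁻¹ • A ^ n) i j) (NormedSpace.exp A i j) :=
    Pi.hasSum.1 (Pi.hasSum.1 h i) j
  refine hij.nonneg fun n => ?_
  rw [Matrix.smul_apply, smul_eq_mul]
  exact mul_nonneg (by positivity) (hp n i j)

theorem exp_entry_nonneg [DecidableEq I] (A : Matrix I I ℝ) (hA : ∀ i j, i ≠ j → 0 ≤ A i j) (i j : I) :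
    0 ≤ NormedSpace.exp A i j := by
  set c : ℝ := ∑ k, |A k k| with hc
  have hsum : A = (A + Matrix.diagonal (fun _ => c)) + Matrix.diagonal (fun _ => -c) := by
    rw [add_assoc, Matrix.diagonal_add]
    simp
  have hcomm : Commute (A + Matrix.diagonal (fun _ => c)) (Matrix.diagonal (fun _ : I => -c)) := by
    have : Matrix.diagonal (fun _ : I => -c) = Matrix.scalar I (-c) := rfl
    rw [this]
    exact (Matrix.scalar_commute (-c) (fun r => Commute.all _ _) _).symm
  rw [hsum, Matrix.exp_add_of_commute _ _ hcomm, Matrix.exp_diagonal]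
  refine mul_entry_nonneg _ _ (exp_entry_nonneg_of_nonneg _ ?_) ?_ i j
  · intro k l
    rw [Matrix.add_apply, Matrix.diagonal_apply]
    split_ifs with hkl
    · subst hkl
      have h1 : |A k k| ≤ c :=
        Finset.single_le_sum (f := fun k => |A k k|) (fun k _ => abs_nonneg _) (Finset.mem_univ k)
      linarith [neg_abs_le (A k k)]
    · simpa using hA k l hkl
  · intro k l
    rw [Matrix.diagonal_apply]
    split_ifs
    · have : NormedSpace.exp (fun _ : I => -c) k = Real.exp (-c) := by
        rw [Pi.exp_def, Real.exp_eq_exp_ℝ]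
      rw [this]
      positivity
    · exact le_rfl

variable [DecidableEq O]

theorem exists_flowLine (a : O) {x : I → ℝ} (hx : x ∈ M.face a) :
    ∃ y, M.IsFlowLine a x y ∧ ∀ t, 0 ≤ t → y t ∈ M.face a := by
  classical
  set A : Matrix I I ℝ := fun i j => if M.obs i = a ∧ M.obs j = a then M.rate i j else 0 with hA
  set u : ℝ → I → ℝ := fun t => x ᵥ* NormedSpace.exp (t • A) with hu
  have hu' : ∀ t, HasDerivAt u (u t ᵥ* A) t := fun t => hasDerivAt_vecMul_exp A x t
  have hu0 : u 0 = x := by simp [hu]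
  have hui' : ∀ t i, HasDerivAt (fun s => u s i) ((u t ᵥ* A) i) t :=
    fun t i => (hasDerivAt_pi.1 (hu' t)) i
  have hcol : ∀ (v : I → ℝ) i, M.obs i ≠ a → (v ᵥ* A) i = 0 := by
    intro v i hi
    simp [Matrix.vecMul, dotProduct, hA, hi]
  have hsupp : ∀ t i, M.obs i ≠ a → u t i = 0 := by
    intro t i hi
    have hconst := is_const_of_deriv_eq_zero (f := fun s => u s i)
      (fun s => (hui' s i).differentiableAt)
      (fun s => by rw [(hui' s i).deriv, hcol _ i hi]) t 0
    rw [hconst, hu0, hx.2 i hi]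
  have hin : ∀ t i, M.obs i = a → (u t ᵥ* A) i = (u t ᵥ* M.rate) i := by
    intro t i hi
    simp only [Matrix.vecMul, dotProduct, hA]
    refine Finset.sum_congr rfl fun j _ => ?_
    by_cases hj : M.obs j = a
    · simp [hi, hj]
    · simp [hsupp t j hj]
  have hnonneg : ∀ t, 0 ≤ t → ∀ i, 0 ≤ u t i := by
    intro t ht i
    refine Finset.sum_nonneg fun j _ => mul_nonneg (hx.1.1 j) (exp_entry_nonneg _ ?_ j i)
    intro k l hkl
    rw [Matrix.smul_apply, smul_eq_mul]
    refine mul_nonneg ht ?_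
    simp only [hA]
    split_ifs
    · exact M.rate_nonneg k l hkl
    · exact le_rfl
  set σ : ℝ → ℝ := fun t => ∑ j, u t j with hσ
  have hσ' : ∀ t, HasDerivAt σ (∑ j, (u t ᵥ* A) j) t := fun t =>
    HasDerivAt.fun_sum fun j _ => hui' t j
  have hσsum : ∀ t, ∑ j, (u t ᵥ* A) j = ∑ j with M.obs j = a, (u t ᵥ* M.rate) j := by
    intro t
    rw [Finset.sum_filter]
    refine Finset.sum_congr rfl fun j _ => ?_
    split_ifs with hj
    · exact hin t j hj
    · exact hcol _ j hj
  have hσpos : ∀ t, 0 ≤ t → 0 < σ t := by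
    intro t ht
    refine lt_of_le_of_ne (Finset.sum_nonneg fun j _ => hnonneg t ht j) fun h0 => ?_
    have hz : u t = 0 := by
      funext i
      exact (Finset.sum_eq_zero_iff_of_nonneg (fun j _ => hnonneg t ht j)).1 h0.symm i
        (Finset.mem_univ i)
    have hx0 : x = 0 := by
      have hunit := Matrix.isUnit_exp (t • A)
      have hinj := Matrix.vecMul_injective_of_isUnit hunit
      apply hinj
      change u t = 0 ᵥ* NormedSpace.exp (t • A)
      rw [hz, Matrix.zero_vecMul]
    have := hx.1.2
    rw [hx0] at this
    simp at this
  refine ⟨fun t i => u t i / σ t, ⟨?_, ?_⟩, ?_⟩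
  · funext i
    have : σ 0 = 1 := by simp only [hσ, hu0]; exact hx.1.2
    simp [this, hu0]
  · intro t ht
    have hne := (hσpos t ht).ne'
    refine HasDerivAt.hasDerivWithinAt (hasDerivAt_pi.2 fun i => ?_)
    refine ((hui' t i).div (hσ' t) hne).congr_deriv ?_
    have hv : ((fun i => u t i / σ t) ᵥ* M.rate) = fun i => (u t ᵥ* M.rate) i / σ t := by
      funext i
      simp only [Matrix.vecMul, dotProduct, Finset.sum_div]
      exact Finset.sum_congr rfl fun j _ => by ring
    symm
    simp only [vectorField, hv, hσsum, ← Finset.sum_div]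
    split_ifs with hi
    · rw [hin t i hi]
      field_simp
    · rw [hcol _ i hi, hsupp t i hi]
      simp
  · intro t ht
    refine ⟨⟨fun i => div_nonneg (hnonneg t ht i) (hσpos t ht).le, ?_⟩, fun i hi => ?_⟩
    · rw [← Finset.sum_div]
      exact div_self (hσpos t ht).ne'
    · simp [hsupp t i hi]

theorem flowLine_unique (a : O) {x : I → ℝ} {y z : ℝ → I → ℝ} (hy : M.IsFlowLine a x y)
    (hz : M.IsFlowLine a x z) (t : ℝ) (ht : 0 ≤ t) : y t = z t := by
  have hcont : ∀ {w : ℝ → I → ℝ}, M.IsFlowLine a x w → ContinuousOn w (Set.Icc 0 t) :=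
    fun hw s hs => ((hw.2 s hs.1).continuousWithinAt).mono Set.Icc_subset_Ici_self
  obtain ⟨R, hR⟩ := ((isCompact_Icc.image_of_continuousOn (hcont hy)).isBounded.union
    (isCompact_Icc.image_of_continuousOn (hcont hz)).isBounded).subset_closedBall 0
  have hF : ContDiff ℝ 1 (M.vectorField a) := by
    refine contDiff_pi.2 fun i => ?_
    unfold vectorField Matrix.vecMul dotProduct
    split_ifs <;> fun_prop
  obtain ⟨K, hK⟩ := (hF.locallyLipschitz.locallyLipschitzOn
    (s := Metric.closedBall 0 R)).exists_lipschitzOnWith_of_compact (isCompact_closedBall 0 R)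
  exact ODE_solution_unique_of_mem_Icc_right (v := fun _ => M.vectorField a)
    (s := fun _ => Metric.closedBall 0 R) (fun _ _ => hK) (hcont hy)
    (fun s hs => (hy.2 s hs.1).mono (Set.Ici_subset_Ici.2 hs.1))
    (fun s hs => hR (Or.inl ⟨s, Set.Ico_subset_Icc_self hs, rfl⟩)) (hcont hz)
    (fun s hs => (hz.2 s hs.1).mono (Set.Ici_subset_Ici.2 hs.1))
    (fun s hs => hR (Or.inr ⟨s, Set.Ico_subset_Icc_self hs, rfl⟩))
    (by rw [hy.1, hz.1]) ⟨ht, le_rfl⟩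

end Flow

/-! ### The flow on the effective simplex -/

section GlobalFlow

variable {I O : Type*} [Fintype I] (M : FilteringModel I O)

/-- The element `a` of `O` such that `x` lies in the face of `a`. -/
noncomputable def label (x : M.effSimplex) : O := (Set.mem_iUnion.1 x.2).choose

theorem mem_face_label (x : M.effSimplex) : x.1 ∈ M.face (M.label x) :=
  (Set.mem_iUnion.1 x.2).choose_spec

theorem face_disjoint {a b : O} {x : I → ℝ} (ha : x ∈ M.face a) (hb : x ∈ M.face b) : a = b := by
  by_contra hab
  have h0 : ∀ i, x i = 0 := fun i => by
    by_cases hi : M.obs i = a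
    · exact hb.2 i (by rw [hi]; exact hab)
    · exact ha.2 i hi
  have := ha.1.2
  simp [h0] at this

variable [DecidableEq O]

/-- The solution of `y' = F_a(y)`, `y(0) = x`, where `x` lies in the face of `a`. -/
noncomputable def flowLine (x : M.effSimplex) : ℝ → I → ℝ :=
  (M.exists_flowLine (M.label x) (M.mem_face_label x)).choose

theorem isFlowLine_flowLine (x : M.effSimplex) :
    M.IsFlowLine (M.label x) x.1 (M.flowLine x) :=
  (M.exists_flowLine (M.label x) (M.mem_face_label x)).choose_spec.1

theorem flowLine_mem_face (x : M.effSimplex) {t : ℝ} (ht : 0 ≤ t) :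
    M.flowLine x t ∈ M.face (M.label x) :=
  (M.exists_flowLine (M.label x) (M.mem_face_label x)).choose_spec.2 t ht

/-- The global flow `φ` on the effective simplex. -/
noncomputable def flow (t : ℝ≥0) (x : M.effSimplex) : M.effSimplex :=
  ⟨M.flowLine x t, Set.mem_iUnion.2 ⟨_, M.flowLine_mem_face x t.2⟩⟩

theorem flow_mem_face (t : ℝ≥0) {x : M.effSimplex} {a : O} (hx : x.1 ∈ M.face a) :
    (M.flow t x).1 ∈ M.face a := by
  rw [M.face_disjoint hx (M.mem_face_label x)]
  exact M.flowLine_mem_face x t.2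

theorem continuous_flow (x : M.effSimplex) : Continuous fun t : ℝ≥0 => M.flow t x := by
  refine Continuous.subtype_mk ?_ _
  have h : ContinuousOn (M.flowLine x) (Set.Ici 0) :=
    fun t ht => ((M.isFlowLine_flowLine x).2 t ht).continuousWithinAt
  exact h.comp_continuous NNReal.continuous_coe fun t => t.2

/-- `H_a` maps vectors that are nonnegative on `obs ⁻¹ {a}` into the face of `a`. -/
theorem H_mem_face (a : O) {v : I → ℝ} (hv : ∀ i, M.obs i = a → 0 ≤ v i) : M.H a v ∈ M.face a := by
  by_cases h0 : ∑ j with M.obs j = a, v j = 0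
  · have : M.H a v = M.ref a := by
      funext i
      by_cases hi : M.obs i = a
      · simp [H, hi, h0]
      · simp [H, hi, M.ref_support a i hi]
    rw [this]
    exact ⟨M.ref_mem a, M.ref_support a⟩
  · have hH : M.H a v = fun i => if M.obs i = a then v i / ∑ j with M.obs j = a, v j else 0 := by
      funext i
      by_cases hi : M.obs i = a <;> simp [H, hi, h0]
    rw [hH]
    refine ⟨⟨fun i => ?_, ?_⟩, fun i hi => by simp [hi]⟩
    · dsimp only
      split_ifs with hi
      · exact div_nonneg (hv i hi)
          (Finset.sum_nonneg fun j hj => hv j (Finset.mem_filter.1 hj).2)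
      · exact le_rfl
    · rw [← Finset.sum_filter, ← Finset.sum_div]
      exact div_self h0

theorem H_vecMul_mem_face {a b : O} (hab : b ≠ a) {x : I → ℝ} (hx : x ∈ M.face a) :
    M.H b (x ᵥ* M.rate) ∈ M.face b := by
  refine M.H_mem_face b fun i hi => Finset.sum_nonneg fun j _ => ?_
  by_cases hj : M.obs j = a
  · refine mul_nonneg (hx.1.1 j) (M.rate_nonneg j i ?_)
    rintro rfl
    exact hab (hi.symm.trans hj)
  · rw [hx.2 j hj, zero_mul]

/-- `H_a[μ]`, as an element of the effective simplex, for a probability `μ`. -/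
noncomputable def condProb (a : O) (μ : stdSimplex ℝ I) : M.effSimplex :=
  ⟨M.H a μ.1, Set.mem_iUnion.2 ⟨a, M.H_mem_face a fun i _ => μ.2.1 i⟩⟩

end GlobalFlow

/-! ### Jump times of the observation process -/

section Jumps

variable {I O : Type*} [Fintype I] [TopologicalSpace I] (M : FilteringModel I O)

/-- The observation process `Y_t = h(X_t)`, `X` being the coordinate process. -/
def Y (ω : CadlagPath I) (t : ℝ≥0) : O := M.obs (ω t)

/-- The set of jump times of `Y`: the times `t > 0` such that `Y` is not constantly equal to `Y_t`
on some interval `(t - ε, t)`. -/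
def jumpSet (ω : CadlagPath I) : Set ℝ≥0 :=
  {t | 0 < t ∧ ¬ ∀ᶠ s in 𝓝[<] t, M.Y ω s = M.Y ω t}

/-- The increasing sequence of jump times of `Y`, with `T₀ = 0`; `Tₙ = ∞` if there are fewer than
`n` jumps. -/
noncomputable def jumpTime (ω : CadlagPath I) : ℕ → ℝ≥0∞
  | 0 => 0
  | n + 1 => ⨅ t ∈ {t : ℝ≥0 | t ∈ M.jumpSet ω ∧ jumpTime ω n < t}, (t : ℝ≥0∞)

variable [DiscreteTopology I]

/-- There are no jumps immediately after `t`. -/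
theorem exists_no_jump_right (ω : CadlagPath I) (t : ℝ≥0) :
    ∃ u > t, ∀ s ∈ Set.Ioo t u, s ∉ M.jumpSet ω := by
  obtain ⟨u, hu, hsub⟩ := (mem_nhdsGE_iff_exists_Ico_subset).1 (CadlagPath.eventually_right ω t)
  refine ⟨u, hu, fun s hs hJ => hJ.2 ?_⟩
  filter_upwards [Ioo_mem_nhdsLT hs.1] with r hr
  have h1 : ω r = ω t := hsub ⟨hr.1.le, hr.2.trans hs.2⟩
  have h2 : ω s = ω t := hsub ⟨hs.1.le, hs.2⟩
  simp only [Y, h1, h2]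

/-- There are no jumps immediately before `t`. -/
theorem exists_no_jump_left (ω : CadlagPath I) {t : ℝ≥0} (ht : 0 < t) :
    ∃ u < t, ∀ s ∈ Set.Ioo u t, s ∉ M.jumpSet ω := by
  obtain ⟨i, hi⟩ := CadlagPath.eventually_left ω ht
  obtain ⟨u, hu, hsub⟩ := (mem_nhdsLT_iff_exists_Ioo_subset' ht).1 hi
  refine ⟨u, hu, fun s hs hJ => hJ.2 ?_⟩
  filter_upwards [Ioo_mem_nhdsLT hs.1] with r hr
  have h1 : ω r = i := hsub ⟨hr.1, hr.2.trans hs.2⟩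
  have h2 : ω s = i := hsub hs
  simp only [Y, h1, h2]

/-- `Y` is constant on intervals without jumps. -/
theorem Y_eq_of_no_jump (ω : CadlagPath I) {s t : ℝ≥0} (hst : s ≤ t)
    (h : ∀ r ∈ Set.Ioc s t, r ∉ M.jumpSet ω) : M.Y ω t = M.Y ω s := by
  let _ : TopologicalSpace O := ⊥
  have : DiscreteTopology O := ⟨rfl⟩
  have hc : ContinuousOn (M.Y ω) (Set.Icc s t) := by
    intro r hr
    have hright : ContinuousWithinAt (M.Y ω) (Set.Ici r) r := by
      refine tendsto_nhds_of_eventually_eq ?_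
      filter_upwards [CadlagPath.eventually_right ω r] with q hq
      simp only [Y, hq]
    rcases hr.1.eq_or_lt with rfl | hlt
    · exact hright.mono Set.Icc_subset_Ici_self
    · have hleft : ContinuousWithinAt (M.Y ω) (Set.Iio r) r := by
        refine tendsto_nhds_of_eventually_eq ?_
        have := h r ⟨hlt, hr.2⟩
        simp only [jumpSet, Set.mem_ofPred_eq, not_and, not_not] at this
        exact this (bot_le.trans_lt hlt)
      exact ((hleft.union hright).mono (by simp)).mono (Set.subset_univ _)
  exact isPreconnected_Icc.constant hc ⟨hst, le_rfl⟩ ⟨le_rfl, hst⟩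

/-- `T_{n+1} > T_n` and `Y_{T_{n+1}} ≠ Y_{T_n}` on `{T_{n+1} < ∞}`. -/
theorem jumpTime_succ_spec (ω : CadlagPath I) {n : ℕ} (hT : M.jumpTime ω (n + 1) < ⊤) :
    M.jumpTime ω n < M.jumpTime ω (n + 1) ∧
      M.Y ω (M.jumpTime ω (n + 1)).toNNReal ≠ M.Y ω (M.jumpTime ω n).toNNReal := by
  set S : Set ℝ≥0 := {t : ℝ≥0 | t ∈ M.jumpSet ω ∧ M.jumpTime ω n < t} with hS
  have hdef : M.jumpTime ω (n + 1) = ⨅ t ∈ S, (t : ℝ≥0∞) := rfl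
  have hne : S.Nonempty := by
    by_contra hempty
    rw [Set.not_nonempty_iff_eq_empty] at hempty
    rw [hdef, hempty] at hT
    simp at hT
  obtain ⟨u, hu, hno⟩ := M.exists_no_jump_right ω (sInf S)
  obtain ⟨s, hs, hsu⟩ := exists_lt_of_csInf_lt hne hu
  have hle : sInf S ≤ s := csInf_le' hs
  have hmem : sInf S ∈ S := by
    rcases hle.eq_or_lt with heq | hlt
    · rw [heq]; exact hs
    · exact absurd hs.1 (hno s ⟨hlt, hsu⟩)
  generalize hτ : sInf S = τ at hmem
  have hval : M.jumpTime ω (n + 1) = τ := by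
    rw [hdef]
    refine le_antisymm (iInf₂_le τ hmem) (le_iInf₂ fun t ht => ?_)
    rw [← hτ]
    exact ENNReal.coe_le_coe.2 (csInf_le' ht)
  rw [hval]
  refine ⟨hmem.2, ?_⟩
  have hfin : M.jumpTime ω n ≠ ⊤ := (hmem.2.trans ENNReal.coe_lt_top).ne
  obtain ⟨a, ha⟩ : ∃ a : ℝ≥0, (a : ℝ≥0∞) = M.jumpTime ω n := ⟨_, ENNReal.coe_toNNReal hfin⟩
  have haτ : a < τ := by
    have := hmem.2
    rwa [← ha, ENNReal.coe_lt_coe] at this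
  rw [← ha, ENNReal.toNNReal_coe, ENNReal.toNNReal_coe]
  intro heq
  refine hmem.1.2 ?_
  filter_upwards [Ioo_mem_nhdsLT haτ] with r hr
  rw [heq]
  refine M.Y_eq_of_no_jump ω hr.1.le fun q hq hJ => ?_
  have hqS : q ∈ S := ⟨hJ, by rw [← ha]; exact ENNReal.coe_lt_coe.2 hq.1⟩
  exact absurd (hτ ▸ csInf_le' hqS) (not_le.2 (lt_of_le_of_lt hq.2 hr.2))

end Jumps

/-! ### The filtering process -/

section Filter

variable {I O : Type*} [Fintype I] [TopologicalSpace I] [DiscreteTopology I] [DecidableEq O]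
  (M : FilteringModel I O)

/-- The post-jump positions `Π_{T_n}` on `{T_n < ∞}`: `Π_0 = H_{Y_0}[μ]` and
`Π_{T_{n+1}} = H_{Y_{T_{n+1}}}[Π_{T_{n+1}-} Λ]`, where
`Π_{T_{n+1}-} = φ(T_{n+1} - T_n, Π_{T_n})`. (The value is irrelevant on `{T_n = ∞}`.) They lie in
the face of `Y_{T_n}`. -/
noncomputable def postJumpAux (μ : stdSimplex ℝ I) (ω : CadlagPath I) : (n : ℕ) →
    {z : M.effSimplex // M.jumpTime ω n < ⊤ → z.1 ∈ M.face (M.Y ω (M.jumpTime ω n).toNNReal)}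
  | 0 => ⟨M.condProb (M.Y ω 0) μ, fun _ => M.H_mem_face (M.Y ω 0) fun i _ => μ.2.1 i⟩
  | n + 1 =>
    have := Classical.dec (M.jumpTime ω (n + 1) < ⊤)
    if hT : M.jumpTime ω (n + 1) < ⊤ then
      have hmem := M.H_vecMul_mem_face (M.jumpTime_succ_spec ω hT).2
        (M.flow_mem_face (M.jumpTime ω (n + 1) - M.jumpTime ω n).toNNReal
          ((postJumpAux μ ω n).2 ((M.jumpTime_succ_spec ω hT).1.trans hT)))
      ⟨⟨M.H (M.Y ω (M.jumpTime ω (n + 1)).toNNReal)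
          ((M.flow (M.jumpTime ω (n + 1) - M.jumpTime ω n).toNNReal
            (postJumpAux μ ω n).1).1 ᵥ* M.rate), Set.mem_iUnion.2 ⟨_, hmem⟩⟩, fun _ => hmem⟩
    else ⟨(postJumpAux μ ω n).1, fun h => absurd h hT⟩

/-- The post-jump position `Π_{T_n}`. -/
noncomputable def postJump (μ : stdSimplex ℝ I) (ω : CadlagPath I) (n : ℕ) : M.effSimplex :=
  (M.postJumpAux μ ω n).1

/-- The number of jumps of `Y` in `(0,t]`, i.e. the `n` such that `T_n ≤ t < T_{n+1}`. -/
noncomputable def jumpCount (ω : CadlagPath I) (t : ℝ≥0) : ℕ := (M.jumpSet ω ∩ Set.Iic t).ncard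

/-- The value `Π_t = φ(t - T_n, Π_{T_n})` for `T_n ≤ t < T_{n+1}`. -/
noncomputable def filterValue (μ : stdSimplex ℝ I) (ω : CadlagPath I) (t : ℝ≥0) : M.effSimplex :=
  M.flow (t - (M.jumpTime ω (M.jumpCount ω t)).toNNReal) (M.postJump μ ω (M.jumpCount ω t))

theorem isCadlag_filterValue (μ : stdSimplex ℝ I) (ω : CadlagPath I) :
    IsCadlag (M.filterValue μ ω) := by
  have hcont : ∀ n, Continuous fun t : ℝ≥0 =>
      M.flow (t - (M.jumpTime ω n).toNNReal) (M.postJump μ ω n) := fun n =>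
    (M.continuous_flow _).comp (by fun_prop)
  constructor
  · intro t
    obtain ⟨u, hu, hno⟩ := M.exists_no_jump_right ω t
    have hev : ∀ s ∈ Set.Ico t u, M.jumpCount ω s = M.jumpCount ω t := by
      intro s hs
      unfold jumpCount
      congr 1
      ext r
      constructor
      · rintro ⟨hr, hrs⟩
        refine ⟨hr, ?_⟩
        by_contra hrt
        exact hno r ⟨not_le.1 hrt, lt_of_le_of_lt hrs hs.2⟩ hr
      · rintro ⟨hr, hrt⟩
        exact ⟨hr, le_trans hrt hs.1⟩
    refine ((hcont (M.jumpCount ω t)).continuousWithinAt).congr_of_eventuallyEq ?_ rfl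
    filter_upwards [Ico_mem_nhdsGE hu] with s hs
    simp only [filterValue, hev s hs]
  · intro t ht
    obtain ⟨u, hu, hno⟩ := M.exists_no_jump_left ω ht
    obtain ⟨v, hv⟩ := exists_between hu
    have hev : ∀ s ∈ Set.Ioo u t, M.jumpCount ω s = M.jumpCount ω v := by
      have key : ∀ s ∈ Set.Ioo u t, M.jumpSet ω ∩ Set.Iic s = M.jumpSet ω ∩ Set.Iic u := by
        intro s hs
        ext r
        constructor
        · rintro ⟨hr, hrs⟩
          refine ⟨hr, ?_⟩
          by_contra hru
          exact hno r ⟨not_le.1 hru, lt_of_le_of_lt hrs hs.2⟩ hr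
        · rintro ⟨hr, hru⟩
          exact ⟨hr, le_trans hru hs.1.le⟩
      intro s hs
      rw [jumpCount, jumpCount, key s hs, key v hv]
    refine ⟨_, ((hcont (M.jumpCount ω v)).continuousWithinAt (s := Set.Iio t)).tendsto.congr' ?_⟩
    filter_upwards [Ioo_mem_nhdsLT hu] with s hs
    simp only [filterValue, hev s hs]

/-- The trajectory `Π^μ_·(ω)` of the filtering process. -/
noncomputable def filterPath (μ : stdSimplex ℝ I) (ω : CadlagPath I) : CadlagPath M.effSimplex :=
  ⟨M.filterValue μ ω, M.isCadlag_filterValue μ ω⟩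

end Filter

/-! ### Laws -/

section Laws

variable {I O : Type*} [Fintype I] [DecidableEq I] [TopologicalSpace I] [DiscreteTopology I]
  [MeasurableSpace I] [DecidableEq O] (M : FilteringModel I O)

/-- `P` is the law on the canonical space of cadlag paths of the Markov process with generator `Λ`
and initial distribution `μ`: `P(X_0 = i) = μ(i)` and
`E[f(X_{t+s}) | F_t] = (e^{sΛ} f)(X_t)` a.s. for all `t, s ≥ 0` and all `f : I → ℝ`. -/
structure IsMarkovLaw (μ : stdSimplex ℝ I) (P : Measure (CadlagPath I)) : Prop where
  isProbabilityMeasure : IsProbabilityMeasure P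
  initial : ∀ i, P {ω | ω 0 = i} = ENNReal.ofReal (μ i)
  markov : ∀ (t s : ℝ≥0) (f : I → ℝ),
    P[fun ω => f (ω (t + s)) | CadlagPath.natFiltration t] =ᵐ[P]
      fun ω => (NormedSpace.exp ((s : ℝ) • M.rate) *ᵥ f) (ω t)

/-- The law `P̄_ν` of the filtering process `Π^ν` under `P_ν`, for `ν` in the effective simplex. -/
noncomputable def pdpLaw (P : stdSimplex ℝ I → Measure (CadlagPath I)) (ν : M.effSimplex) :
    Measure (CadlagPath M.effSimplex) :=
  (P (M.effToSimplex ν)).map (M.filterPath (M.effToSimplex ν))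

/-- The law `P̄_Q(Γ) = ∫ P̄_ν(Γ) Q(dν)` with initial distribution `Q`. -/
noncomputable def pdpLawOfInitial (P : stdSimplex ℝ I → Measure (CadlagPath I))
    (Q : Measure M.effSimplex) : Measure (CadlagPath M.effSimplex) :=
  Q.bind (M.pdpLaw P)

/-- The probability `∑_a μ(h⁻¹(a)) δ_{H_a[μ]}` on the effective simplex. -/
noncomputable def initialLaw [Fintype O] (μ : stdSimplex ℝ I) : Measure M.effSimplex :=
  ∑ a, ENNReal.ofReal (∑ i with M.obs i = a, μ i) • Measure.dirac (M.condProb a μ)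

end Laws

end FilteringModel

/-!
The law of a Markov chain is linear in its initial distribution: conditioning successively on the
past, the finite-dimensional distributions are `∑ i, μ i * g i`, where `g` does not depend on `μ`
(`exists_measureReal_cylinder_eq`), and they determine the law (`IsMarkovLaw.eq_sum`). Applied to the
decomposition `μ = ∑ₐ μ(h⁻¹(a)) H_a[μ]` (`sum_mul_H`), this gives
`P_μ = ∑ₐ μ(h⁻¹(a)) P_{H_a[μ]}`.

Under `P_{H_a[μ]}` one has `Y₀ = a` almost surely, so that `Π^μ` starts at `H_a[μ]`, as does the
filtering process with initial distribution `H_a[μ]`, because `H_a` fixes the face of `a`. From then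
on both processes follow the same recursion, driven by the observed path (`filterPath_congr`); so they
coincide almost surely, and the law of `Π^μ` under `P_{H_a[μ]}` is `P̄_{H_a[μ]}`
(`map_filterPath_condProb`). Summing over `a` gives `P̄_Q`. No filtering property of `Π^μ` is involved.

The remaining point is the measurability of `Π^μ`. The flow is jointly measurable, being continuous in
each variable (`continuous_flow_left` for the initial condition). By right continuity, evaluation
`(ω, t) ↦ ω t` is jointly measurable and the event `T_{n+1} < t` can be read off from countably many
times (`jumpTime_succ_lt_iff`). Then `T_n` and the post-jump positions are measurable by induction on
`n`, and `Π^μ_t` is obtained from them by selecting the `n` with `T_n ≤ t < T_{n+1}`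
(`jumpCount_eq_iff`).
-/

/-! ### Coordinates and σ-algebras on the path space -/

namespace CadlagPath

variable {E : Type*} [TopologicalSpace E] [MeasurableSpace E]

theorem measurable_eval (t : ℝ≥0) : Measurable fun ω : CadlagPath E => ω t :=
  Measurable.of_comap_le
    (le_iSup (fun t : ℝ≥0 => MeasurableSpace.comap (fun ω : CadlagPath E => ω t) inferInstance) t)

theorem measurable_natFiltration_eval {s t : ℝ≥0} (hst : s ≤ t) :
    Measurable[natFiltration t] fun ω : CadlagPath E => ω s :=
  Measurable.of_comap_le (le_iSup
    (fun s : Set.Iic t => MeasurableSpace.comap (fun ω : CadlagPath E => ω (s : ℝ≥0)) inferInstance)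
    ⟨s, hst⟩)

theorem natFiltration_mono {s t : ℝ≥0} (hst : s ≤ t) :
    natFiltration (E := E) s ≤ natFiltration t :=
  iSup_le fun r => (measurable_natFiltration_eval (r.2.trans hst)).comap_le

theorem natFiltration_le (t : ℝ≥0) :
    natFiltration (E := E) t ≤ (inferInstance : MeasurableSpace (CadlagPath E)) :=
  iSup_le fun s => (measurable_eval s.1).comap_le

theorem measurable_iff_eval {α : Type*} [MeasurableSpace α] {f : α → CadlagPath E} :
    Measurable f ↔ ∀ t : ℝ≥0, Measurable fun x => f x t := by
  refine ⟨fun h t => (measurable_eval t).comp h, fun h => ?_⟩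
  refine Measurable.of_le_map (iSup_le fun t => ?_)
  rintro _ ⟨s, hs, rfl⟩
  exact h t hs

/-- A right-continuous path is determined near `t` by its values at countably many times to the
right of `t`; hence evaluation is jointly measurable in the path and the time. -/
theorem measurable_eval_uncurry {I : Type*} [Countable I] [TopologicalSpace I] [DiscreteTopology I]
    [MeasurableSpace I] [DiscreteMeasurableSpace I] :
    Measurable fun p : CadlagPath I × ℝ≥0 => p.1 p.2 := by
  obtain ⟨D, hDc, hD⟩ := TopologicalSpace.exists_countable_dense ℝ≥0
  refine measurable_to_countable' fun i => ?_
  have heq : (fun p : CadlagPath I × ℝ≥0 => p.1 p.2) ⁻¹' {i} =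
      ⋃ q ∈ D, ⋂ r ∈ D, {p : CadlagPath I × ℝ≥0 | p.2 < q ∧ (p.2 < r → r < q → p.1 r = i)} := by
    ext ⟨ω, t⟩
    simp only [mem_preimage, mem_singleton_iff, mem_iUnion, mem_iInter, mem_ofPred_eq, exists_prop]
    obtain ⟨u, hu, hsub⟩ := mem_nhdsGE_iff_exists_Ico_subset.1 (eventually_right ω t)
    constructor
    · intro h
      obtain ⟨q, hqD, hq⟩ := hD.exists_between hu
      exact ⟨q, hqD, fun r _ => ⟨hq.1, fun h1 h2 => by
        have h3 : ω r = ω t := hsub ⟨h1.le, h2.trans hq.2⟩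
        exact h3.trans h⟩⟩
    · rintro ⟨q, hqD, hq⟩
      have htq : t < min u q := lt_min hu (hq q hqD).1
      obtain ⟨r, hrD, hr⟩ := hD.exists_between htq
      have h3 : ω r = ω t := hsub ⟨hr.1.le, hr.2.trans_le (min_le_left _ _)⟩
      exact h3.symm.trans ((hq r hrD).2 hr.1 (hr.2.trans_le (min_le_right _ _)))
  rw [heq]
  refine MeasurableSet.biUnion hDc fun q _ => MeasurableSet.biInter hDc fun r _ => ?_
  refine (measurableSet_lt measurable_snd measurable_const).inter ?_
  have h1 : MeasurableSet {p : CadlagPath I × ℝ≥0 | p.2 < r} :=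
    measurableSet_lt measurable_snd measurable_const
  have h2 : MeasurableSet {p : CadlagPath I × ℝ≥0 | p.1 r = i} :=
    ((measurable_eval r).comp measurable_fst) (measurableSet_singleton i)
  exact h1.imp ((MeasurableSet.const (r < q)).imp h2)

end CadlagPath

/-! ### Finite-dimensional distributions of Markov laws -/

namespace FilteringModel

section MarkovLaw

variable {I O : Type*} [Fintype I] [DecidableEq I] [TopologicalSpace I] [MeasurableSpace I]
  [DiscreteMeasurableSpace I] (M : FilteringModel I O)

/-- Backward recursion along the times of `s`: conditionally on the past up to time `t`, the
expectation of a product of functions of the coordinates at times after `t` is a function `g` of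
the coordinate at time `t`, and `g` depends neither on the law nor on its initial distribution. -/
theorem exists_integral_mul_prod_eval_eq (f : ℝ≥0 → I → ℝ) (s : Finset ℝ≥0) :
    ∀ t : ℝ≥0, (∀ u ∈ s, t ≤ u) → ∃ g : I → ℝ, ∀ (μ : stdSimplex ℝ I) (P : Measure (CadlagPath I)),
      M.IsMarkovLaw μ P → ∀ (Z : CadlagPath I → ℝ) (C : ℝ),
        Measurable[CadlagPath.natFiltration t] Z → (∀ ω, |Z ω| ≤ C) →
        ∫ ω, Z ω * ∏ u ∈ s, f u (ω u) ∂P = ∫ ω, Z ω * g (ω t) ∂P := by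
  induction s using Finset.induction_on_min with
  | empty => exact fun t _ => ⟨fun _ => 1, fun μ P _ Z C _ _ => by simp⟩
  | insert v s hv ih =>
    intro t ht
    obtain ⟨g, hg⟩ := ih v fun u hu => (hv u hu).le
    have htv : t ≤ v := ht v (Finset.mem_insert_self v s)
    set k : I → ℝ := fun i => f v i * g i with hk
    refine ⟨NormedSpace.exp (((v - t : ℝ≥0) : ℝ) • M.rate) *ᵥ k, fun μ P hP Z C hZ hZC => ?_⟩
    have := hP.isProbabilityMeasure
    have hvs : v ∉ s := fun h => lt_irrefl v (hv v h)
    obtain ⟨B, hB⟩ : ∃ B, ∀ i, |f v i| ≤ B := by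
      obtain ⟨B, hB⟩ := (Set.finite_range fun i => |f v i|).bddAbove
      exact ⟨B, fun i => hB ⟨i, rfl⟩⟩
    obtain ⟨D, hD⟩ : ∃ D, ∀ i, |k i| ≤ D := by
      obtain ⟨D, hD⟩ := (Set.finite_range fun i => |k i|).bddAbove
      exact ⟨D, fun i => hD ⟨i, rfl⟩⟩
    have h1 := hg μ P hP (fun ω => Z ω * f v (ω v)) (C * B)
      ((hZ.mono (CadlagPath.natFiltration_mono htv) le_rfl).mul
        (Measurable.of_discrete.comp (CadlagPath.measurable_natFiltration_eval le_rfl)))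
      (fun ω => by
        rw [abs_mul]
        exact mul_le_mul (hZC ω) (hB _) (abs_nonneg _) ((abs_nonneg _).trans (hZC ω)))
    have h2 : ∀ ω : CadlagPath I, Z ω * ∏ u ∈ insert v s, f u (ω u) =
        Z ω * f v (ω v) * ∏ u ∈ s, f u (ω u) := fun ω => by
      rw [Finset.prod_insert hvs, mul_assoc]
    simp only [h2]
    rw [h1]
    have hkm : Measurable fun ω : CadlagPath I => k (ω v) :=
      (Measurable.of_discrete (f := k)).comp (CadlagPath.measurable_eval v)
    have hki : Integrable (fun ω : CadlagPath I => k (ω v)) P :=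
      Integrable.of_bound hkm.aestronglyMeasurable D
        (Eventually.of_forall fun ω => by simpa using hD (ω v))
    have h3 := condExp_stronglyMeasurable_mul_of_bound (CadlagPath.natFiltration_le t) (μ := P)
      hZ.stronglyMeasurable hki C (Eventually.of_forall fun ω => by simpa using hZC ω)
    have h4 := hP.markov t (v - t) k
    rw [add_tsub_cancel_of_le htv] at h4
    have h5 := integral_condExp (μ := P) (CadlagPath.natFiltration_le t)
      (f := Z * fun ω : CadlagPath I => k (ω v))
    calc ∫ ω, Z ω * f v (ω v) * g (ω v) ∂P
        = ∫ ω, (Z * fun ω : CadlagPath I => k (ω v)) ω ∂P := by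
          refine integral_congr_ae (Eventually.of_forall fun ω => ?_)
          simp [hk, mul_assoc]
      _ = _ := by
          rw [← h5]
          refine integral_congr_ae ?_
          filter_upwards [h3, h4] with ω hω3 hω4
          rw [hω3, Pi.mul_apply, hω4]

/-- The finite-dimensional distributions are linear in the initial distribution: `g i` is the
probability of the cylinder under the chain started at `i`. -/
theorem exists_measureReal_cylinder_eq (s : Finset ℝ≥0) (A : ℝ≥0 → Set I) :
    ∃ g : I → ℝ, ∀ (μ : stdSimplex ℝ I) (P : Measure (CadlagPath I)), M.IsMarkovLaw μ P →
      P.real {ω | ∀ u ∈ s, ω u ∈ A u} = ∑ i, μ i * g i := by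
  obtain ⟨g, hg⟩ := M.exists_integral_mul_prod_eval_eq
    (fun u => (A u).indicator fun _ => 1) s 0 fun _ _ => zero_le
  refine ⟨g, fun μ P hP => ?_⟩
  have := hP.isProbabilityMeasure
  have h := hg μ P hP (fun _ => 1) 1 measurable_const (by simp)
  have hmeas : MeasurableSet {ω : CadlagPath I | ∀ u ∈ s, ω u ∈ A u} := by
    have : {ω : CadlagPath I | ∀ u ∈ s, ω u ∈ A u} =
        ⋂ u ∈ s, (fun ω : CadlagPath I => ω u) ⁻¹' A u := by
      ext; simp
    rw [this]
    exact Finset.measurableSet_biInter _ fun u _ =>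
      CadlagPath.measurable_eval u (MeasurableSet.of_discrete)
  have h1 : ∀ ω : CadlagPath I, 1 * ∏ u ∈ s, (A u).indicator (fun _ => (1 : ℝ)) (ω u) =
      {ω : CadlagPath I | ∀ u ∈ s, ω u ∈ A u}.indicator 1 ω := by
    intro ω
    by_cases hω : ∀ u ∈ s, ω u ∈ A u
    · rw [indicator_of_mem (show ω ∈ {ω : CadlagPath I | ∀ u ∈ s, ω u ∈ A u} from hω), one_mul,
        Pi.one_apply]
      exact Finset.prod_eq_one fun u hu => indicator_of_mem (hω u hu) _
    · rw [indicator_of_notMem (show ω ∉ {ω : CadlagPath I | ∀ u ∈ s, ω u ∈ A u} from hω), one_mul]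
      push Not at hω
      obtain ⟨u, hu, hn⟩ := hω
      exact Finset.prod_eq_zero hu (indicator_of_notMem hn _)
  simp only [h1] at h
  rw [integral_indicator_one hmeas] at h
  rw [h]
  have h2 : ∀ ω : CadlagPath I, 1 * g (ω 0) =
      ∑ i, ((fun ω : CadlagPath I => ω 0) ⁻¹' {i}).indicator (fun _ => g i) ω := by
    intro ω
    rw [Finset.sum_eq_single (ω 0)]
    · simp
    · intro i _ hi
      rw [indicator_of_notMem]
      exact fun h => hi (mem_singleton_iff.1 h).symm
    · simp
  simp only [h2]
  have hm0 : ∀ i : I, MeasurableSet ((fun ω : CadlagPath I => ω 0) ⁻¹' {i}) := fun i =>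
    CadlagPath.measurable_eval 0 (measurableSet_singleton i)
  rw [integral_finsetSum _ fun i _ => (integrable_const (g i)).indicator (hm0 i)]
  refine Finset.sum_congr rfl fun i _ => ?_
  rw [integral_indicator_const _ (hm0 i), smul_eq_mul]
  congr 1
  have h3 : P ((fun ω : CadlagPath I => ω 0) ⁻¹' {i}) = ENNReal.ofReal (μ i) := hP.initial i
  rw [measureReal_def, h3, ENNReal.toReal_ofReal]
  exact μ.2.1 i

/-- A Markov law whose initial distribution is a mixture is the mixture of the Markov laws. (With a
single component this is the uniqueness of the Markov law.) -/
theorem IsMarkovLaw.eq_sum {ι : Type*} [Fintype ι] {M : FilteringModel I O} {μ : stdSimplex ℝ I}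
    {P : Measure (CadlagPath I)} (hP : M.IsMarkovLaw μ P) (c : ι → ℝ) (hc : ∀ a, 0 ≤ c a)
    (ν : ι → stdSimplex ℝ I) {Q : ι → Measure (CadlagPath I)} (hQ : ∀ a, M.IsMarkovLaw (ν a) (Q a))
    (hμ : ∀ i, μ i = ∑ a, c a * ν a i) :
    P = ∑ a, ENNReal.ofReal (c a) • Q a := by
  have := hP.isProbabilityMeasure
  have := fun a => (hQ a).isProbabilityMeasure
  have key : ∀ (s : Finset ℝ≥0) (A : ℝ≥0 → Set I), P {ω | ∀ u ∈ s, ω u ∈ A u} =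
      (∑ a, ENNReal.ofReal (c a) • Q a) {ω | ∀ u ∈ s, ω u ∈ A u} := by
    intro s A
    obtain ⟨g, hg⟩ := M.exists_measureReal_cylinder_eq s A
    rw [Measure.finsetSum_apply, ← ofReal_measureReal, hg μ P hP]
    simp only [Measure.smul_apply, smul_eq_mul]
    have h1 : ∀ a, ENNReal.ofReal (c a) * Q a {ω | ∀ u ∈ s, ω u ∈ A u} =
        ENNReal.ofReal (c a * ∑ i, ν a i * g i) := by
      intro a
      rw [ENNReal.ofReal_mul (hc a), ← hg _ _ (hQ a), ofReal_measureReal]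
    rw [Finset.sum_congr rfl fun a _ => h1 a, ← ENNReal.ofReal_sum_of_nonneg]
    · congr 1
      simp only [hμ, Finset.sum_mul, Finset.mul_sum]
      rw [Finset.sum_comm]
      simp only [mul_assoc]
    · intro a _
      refine mul_nonneg (hc a) ?_
      rw [← hg _ _ (hQ a)]
      exact measureReal_nonneg
  -- the events `{ω | ∀ u ∈ s, ω u ∈ A u}`, `s` finite, form a π-system generating the σ-algebra
  let m : ℝ≥0 → MeasurableSpace (CadlagPath I) := fun t =>
    MeasurableSpace.comap (fun ω : CadlagPath I => ω t) inferInstance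
  refine ext_of_generate_finite (piiUnionInter (fun t => {s | MeasurableSet[m t] s}) univ)
    ((generateFrom_piiUnionInter_measurableSet m univ).trans (iSup_congr fun _ => by simp [m])).symm
    (isPiSystem_piiUnionInter _ (fun t => @MeasurableSpace.isPiSystem_measurableSet _ (m t)) _) ?_ ?_
  · rintro _ ⟨s, -, F, hF, rfl⟩
    choose! A hA using hF
    have : (⋂ x ∈ s, F x) = {ω : CadlagPath I | ∀ u ∈ s, ω u ∈ A u} := by
      ext ω
      simp only [mem_iInter, mem_ofPred_eq]
      exact forall₂_congr fun u hu => by rw [← (hA u hu).2]; rfl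
    rw [this]
    exact key s A
  · simpa using key ∅ fun _ => univ

end MarkovLaw

end FilteringModel

/-! ### Measurability of the flow -/

namespace FilteringModel

section FlowMeasurability

variable {I O : Type*} [Fintype I] (M : FilteringModel I O)

theorem isClosed_face (a : O) : IsClosed (M.face a) := by
  have h : M.face a = stdSimplex ℝ I ∩ ⋂ (i) (_ : M.obs i ≠ a), {x | x i = 0} := by
    ext x
    simp [face]
  rw [h]
  exact (isClosed_stdSimplex ℝ I).inter (isClosed_iInter fun i => isClosed_iInter fun _ =>
    isClosed_eq (continuous_apply i) continuous_const)

theorem measurableSet_effSimplex [Finite O] : MeasurableSet M.effSimplex :=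
  MeasurableSet.iUnion fun a => (M.isClosed_face a).measurableSet

theorem isCompact_face (a : O) : IsCompact (M.face a) :=
  (isCompact_stdSimplex ℝ I).of_isClosed_subset (M.isClosed_face a) fun _ h => h.1

variable [DecidableEq O]

theorem exists_lipschitzOnWith_vectorField (a : O) :
    ∃ K, LipschitzOnWith K (M.vectorField a) (M.face a) := by
  have hF : ContDiff ℝ 1 (M.vectorField a) := by
    refine contDiff_pi.2 fun i => ?_
    unfold vectorField Matrix.vecMul dotProduct
    split_ifs <;> fun_prop
  exact (hF.locallyLipschitz.locallyLipschitzOn (s := M.face a)).exists_lipschitzOnWith_of_compact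
    (M.isCompact_face a)

/-- Continuous dependence on the initial condition: on each face this is the Grönwall inequality,
and the faces form a finite closed cover of the effective simplex. -/
theorem continuous_flow_left [Finite O] (t : ℝ≥0) : Continuous (M.flow t) := by
  refine LocallyFinite.continuous (f := fun a : O => {x : M.effSimplex | x.1 ∈ M.face a})
    (locallyFinite_of_finite _) ?_ (fun a => (M.isClosed_face a).preimage continuous_subtype_val)
    fun a => ?_
  · exact eq_univ_of_forall fun x => mem_iUnion.2 ⟨M.label x, M.mem_face_label x⟩
  · obtain ⟨K, hK⟩ := M.exists_lipschitzOnWith_vectorField a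
    have hlip : LipschitzOnWith (Real.toNNReal (Real.exp (K * t))) (M.flow t)
        {x : M.effSimplex | x.1 ∈ M.face a} := by
      refine LipschitzOnWith.of_dist_le_mul fun x hx y hy => ?_
      have hline : ∀ z : M.effSimplex, z.1 ∈ M.face a → M.IsFlowLine a z.1 (M.flowLine z) ∧
          ∀ s, 0 ≤ s → M.flowLine z s ∈ M.face a := by
        intro z hz
        rw [M.face_disjoint hz (M.mem_face_label z)]
        exact ⟨M.isFlowLine_flowLine z, fun s hs => M.flowLine_mem_face z hs⟩
      obtain ⟨hx1, hx2⟩ := hline x hx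
      obtain ⟨hy1, hy2⟩ := hline y hy
      have hcont : ∀ {x : I → ℝ} {w : ℝ → I → ℝ}, M.IsFlowLine a x w →
          ContinuousOn w (Icc 0 (t : ℝ)) :=
        fun hw s hs => (hw.2 s hs.1).continuousWithinAt.mono Icc_subset_Ici_self
      have h := dist_le_of_trajectories_ODE_of_mem (v := fun _ => M.vectorField a)
        (s := fun _ => M.face a) (fun _ _ => hK) (hcont hx1)
        (fun s hs => (hx1.2 s hs.1).mono (Ici_subset_Ici.2 hs.1)) (fun s hs => hx2 s hs.1)
        (hcont hy1) (fun s hs => (hy1.2 s hs.1).mono (Ici_subset_Ici.2 hs.1))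
        (fun s hs => hy2 s hs.1) (by rw [hx1.1, hy1.1]) t ⟨t.2, le_rfl⟩
      rw [sub_zero] at h
      rw [Real.coe_toNNReal _ (Real.exp_pos _).le, mul_comm]
      exact h
    exact hlip.continuousOn

theorem measurable_flow_uncurry [Finite O] :
    Measurable fun p : ℝ≥0 × M.effSimplex => M.flow p.1 p.2 :=
  measurable_uncurry_of_continuous_of_measurable (u := M.flow) M.continuous_flow
    fun t => (M.continuous_flow_left t).measurable

theorem measurable_H (a : O) : Measurable (M.H a) := by
  refine measurable_pi_iff.2 fun i => ?_
  have hsum : Measurable fun v : I → ℝ => ∑ j with M.obs j = a, v j :=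
    Finset.measurable_fun_sum _ fun j _ => measurable_pi_apply j
  unfold H
  split_ifs with hi
  · exact measurable_const
  · exact Measurable.ite (measurableSet_eq_fun hsum measurable_const).compl
      ((measurable_pi_apply i).div hsum) measurable_const

end FlowMeasurability

/-! ### Jump times and jump counts -/

section JumpTimes

variable {I O : Type*} [Fintype I] [TopologicalSpace I] (M : FilteringModel I O)

theorem jumpTime_succ_le (ω : CadlagPath I) {n : ℕ} {s : ℝ≥0} (hs : s ∈ M.jumpSet ω)
    (hlt : M.jumpTime ω n < s) : M.jumpTime ω (n + 1) ≤ s :=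
  iInf₂_le s ⟨hs, hlt⟩

theorem jumpSet_inter_Iic_eq (ω : CadlagPath I) {n : ℕ} {τ t : ℝ≥0} (hτ : M.jumpTime ω n = τ)
    (h1 : τ ≤ t) (h2 : t < M.jumpTime ω (n + 1)) :
    M.jumpSet ω ∩ Iic t = M.jumpSet ω ∩ Iic τ := by
  ext s
  refine and_congr_right fun hs => ⟨fun hst => ?_, fun hst => le_trans hst h1⟩
  refine not_lt.1 fun (hlt : τ < s) => ?_
  have := M.jumpTime_succ_le ω hs (n := n) (by rw [hτ]; exact ENNReal.coe_lt_coe.2 hlt)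
  exact absurd (this.trans (ENNReal.coe_le_coe.2 hst)) (not_le.2 h2)

variable [DiscreteTopology I]

/-- A finite jump time is a jump: jumps do not accumulate from the right, so that the infimum
defining it is attained. -/
theorem jumpTime_succ_mem (ω : CadlagPath I) {n : ℕ} {τ : ℝ≥0} (hτ : M.jumpTime ω (n + 1) = τ) :
    τ ∈ M.jumpSet ω := by
  by_contra hn
  obtain ⟨u, hu, hno⟩ := M.exists_no_jump_right ω τ
  have hle : (u : ℝ≥0∞) ≤ M.jumpTime ω (n + 1) := by
    refine le_iInf₂ fun s hs => ENNReal.coe_le_coe.2 ?_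
    by_contra! hsu
    have hτs : τ ≤ s := by
      rw [← ENNReal.coe_le_coe, ← hτ]
      exact iInf₂_le s hs
    rcases hτs.eq_or_lt with rfl | hlt
    · exact hn hs.1
    · exact hno s ⟨hlt, hsu⟩ hs.1
  rw [hτ, ENNReal.coe_le_coe] at hle
  exact absurd hu (not_lt.2 hle)

theorem jumpTime_lt_succ_of_le (ω : CadlagPath I) {n : ℕ} {t : ℝ≥0}
    (ht : M.jumpTime ω (n + 1) ≤ t) : M.jumpTime ω n < M.jumpTime ω (n + 1) :=
  (M.jumpTime_succ_spec ω (ht.trans_lt ENNReal.coe_lt_top)).1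

/-- The jumps have no accumulation point. -/
theorem finite_jumpSet_inter_Iic (ω : CadlagPath I) (t : ℝ≥0) : (M.jumpSet ω ∩ Iic t).Finite := by
  by_contra hinf
  obtain ⟨x, -, hx⟩ := Set.Infinite.exists_accPt_of_subset_isCompact hinf
    (isCompact_Icc (a := (0 : ℝ≥0)) (b := t)) fun s hs => ⟨zero_le, hs.2⟩
  rw [accPt_iff_frequently_nhdsNE] at hx
  refine hx ?_
  rw [← nhdsLT_sup_nhdsGT, eventually_sup]
  constructor
  · rcases (zero_le (a := x)).eq_or_lt with rfl | h0
    · filter_upwards [self_mem_nhdsWithin] with s hs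
      exact absurd (mem_Iio.1 hs) not_lt_zero
    · obtain ⟨u, hu, hno⟩ := M.exists_no_jump_left ω h0
      filter_upwards [Ioo_mem_nhdsLT hu] with s hs h
      exact hno s hs h.1
  · obtain ⟨u, hu, hno⟩ := M.exists_no_jump_right ω x
    filter_upwards [Ioo_mem_nhdsGT hu] with s hs h
    exact hno s hs h.1

/-- There are exactly `n` jumps up to `T_n`, if `T_n` is finite. -/
theorem jumpCount_jumpTime (ω : CadlagPath I) (n : ℕ) :
    ∀ τ : ℝ≥0, M.jumpTime ω n = τ → M.jumpCount ω τ = n := by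
  induction n with
  | zero =>
    intro τ hτ
    have h0 : τ = 0 := by
      have : ((0 : ℝ≥0) : ℝ≥0∞) = τ := hτ
      exact (ENNReal.coe_injective this).symm
    have : M.jumpSet ω ∩ Iic τ = ∅ := by
      rw [h0, eq_empty_iff_forall_notMem]
      rintro s ⟨hs, hs0⟩
      exact absurd hs.1 (not_lt.2 hs0)
    rw [jumpCount, this, ncard_empty]
  | succ n ih =>
    intro τ hτ
    have hlt := M.jumpTime_lt_succ_of_le ω hτ.le
    obtain ⟨σ, hσ⟩ : ∃ σ : ℝ≥0, M.jumpTime ω n = σ :=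
      ⟨_, (ENNReal.coe_toNNReal (hlt.trans_le le_top).ne).symm⟩
    have hστ : σ < τ := by rwa [hσ, hτ, ENNReal.coe_lt_coe] at hlt
    have hset : M.jumpSet ω ∩ Iic τ = insert τ (M.jumpSet ω ∩ Iic σ) := by
      ext s
      constructor
      · rintro ⟨hs, hsτ⟩
        by_cases hsσ : s ≤ σ
        · exact Or.inr ⟨hs, hsσ⟩
        · left
          have := M.jumpTime_succ_le ω hs (n := n)
            (by rw [hσ]; exact ENNReal.coe_lt_coe.2 (not_le.1 hsσ))
          rw [hτ, ENNReal.coe_le_coe] at this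
          exact le_antisymm hsτ this
      · rintro (rfl | ⟨hs, hsσ⟩)
        · exact ⟨M.jumpTime_succ_mem ω hτ, self_mem_Iic⟩
        · exact ⟨hs, le_trans hsσ hστ.le⟩
    rw [jumpCount, hset, ncard_insert_of_notMem (fun h => absurd h.2 (not_le.2 hστ))
      (M.finite_jumpSet_inter_Iic ω σ)]
    congr 1
    exact ih σ hσ

theorem jumpTime_le_iff (ω : CadlagPath I) (t : ℝ≥0) (n : ℕ) :
    M.jumpTime ω n ≤ t ↔ n ≤ M.jumpCount ω t := by
  constructor
  · intro h
    obtain ⟨σ, hσ⟩ : ∃ σ : ℝ≥0, M.jumpTime ω n = σ :=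
      ⟨_, (ENNReal.coe_toNNReal (h.trans_lt ENNReal.coe_lt_top).ne).symm⟩
    rw [← M.jumpCount_jumpTime ω n σ hσ]
    rw [hσ, ENNReal.coe_le_coe] at h
    exact ncard_le_ncard (inter_subset_inter_right _ (Iic_subset_Iic.2 h))
      (M.finite_jumpSet_inter_Iic ω t)
  · contrapose!
    induction n with
    | zero => exact fun h => absurd h not_lt_zero
    | succ n ih =>
      intro h
      by_cases hn : t < M.jumpTime ω n
      · exact (ih hn).trans (Nat.lt_succ_self n)
      · rw [not_lt] at hn
        obtain ⟨σ, hσ⟩ : ∃ σ : ℝ≥0, M.jumpTime ω n = σ :=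
          ⟨_, (ENNReal.coe_toNNReal (hn.trans_lt ENNReal.coe_lt_top).ne).symm⟩
        have hσt : σ ≤ t := by rwa [hσ, ENNReal.coe_le_coe] at hn
        rw [jumpCount, M.jumpSet_inter_Iic_eq ω hσ hσt h]
        exact (M.jumpCount_jumpTime ω n σ hσ).trans_lt (Nat.lt_succ_self n)

theorem jumpCount_eq_iff (ω : CadlagPath I) (t : ℝ≥0) (n : ℕ) :
    M.jumpCount ω t = n ↔ M.jumpTime ω n ≤ t ∧ t < M.jumpTime ω (n + 1) := by
  rw [← not_le, jumpTime_le_iff, jumpTime_le_iff]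
  omega

/-- By right continuity the first jump after `T_n` is visible at the times of a dense set `D`; for a
countable `D` this gives the measurability of the jump times. -/
theorem jumpTime_succ_lt_iff {D : Set ℝ≥0} (hD : Dense D) (ω : CadlagPath I) (n : ℕ) (t : ℝ≥0∞) :
    M.jumpTime ω (n + 1) < t ↔ ∃ q ∈ D, (q : ℝ≥0∞) < t ∧ M.jumpTime ω n < q ∧
      M.Y ω q ≠ M.Y ω (M.jumpTime ω n).toNNReal := by
  constructor
  · intro h
    obtain ⟨hlt, hne⟩ := M.jumpTime_succ_spec ω (h.trans_le le_top)
    obtain ⟨τ, hτ⟩ : ∃ τ : ℝ≥0, M.jumpTime ω (n + 1) = τ :=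
      ⟨_, (ENNReal.coe_toNNReal (h.trans_le le_top).ne).symm⟩
    obtain ⟨u, hu, hsub⟩ := mem_nhdsGE_iff_exists_Ico_subset.1 (ω.eventually_right τ)
    obtain ⟨v, hv1, hv2⟩ := ENNReal.lt_iff_exists_nnreal_btwn.1 h
    rw [hτ, ENNReal.coe_lt_coe] at hv1
    obtain ⟨q, hqD, hq⟩ := hD.exists_between (lt_min hu hv1)
    refine ⟨q, hqD, (ENNReal.coe_lt_coe.2 (hq.2.trans_le (min_le_right _ _))).trans hv2, ?_, ?_⟩
    · exact hlt.trans (by rw [hτ]; exact ENNReal.coe_lt_coe.2 hq.1)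
    · have h3 : ω q = ω τ := hsub ⟨hq.1.le, hq.2.trans_le (min_le_left _ _)⟩
      rw [hτ, ENNReal.toNNReal_coe] at hne
      simpa only [Y, h3] using hne
  · rintro ⟨q, -, hqt, hlt, hne⟩
    refine lt_of_le_of_lt ?_ hqt
    obtain ⟨σ, hσ⟩ : ∃ σ : ℝ≥0, M.jumpTime ω n = σ :=
      ⟨_, (ENNReal.coe_toNNReal (hlt.trans_le le_top).ne).symm⟩
    rw [hσ, ENNReal.toNNReal_coe] at hne
    have hσq : σ < q := by rwa [hσ, ENNReal.coe_lt_coe] at hlt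
    by_contra! hcon
    refine hne (M.Y_eq_of_no_jump ω hσq.le fun r hr hJ => ?_)
    have := M.jumpTime_succ_le ω hJ (n := n) (by rw [hσ]; exact ENNReal.coe_lt_coe.2 hr.1)
    exact absurd (this.trans (ENNReal.coe_le_coe.2 hr.2)) (not_le.2 hcon)

end JumpTimes

section JumpMeasurability

variable {I O : Type*} [Fintype I] [TopologicalSpace I] [DiscreteTopology I] [MeasurableSpace I]
  [DiscreteMeasurableSpace I] (M : FilteringModel I O)

theorem measurable_jumpTime (n : ℕ) : Measurable fun ω => M.jumpTime ω n := by
  induction n with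
  | zero => exact measurable_const
  | succ n ih =>
    obtain ⟨D, hDc, hD⟩ := TopologicalSpace.exists_countable_dense ℝ≥0
    refine measurable_of_Iio fun t => ?_
    have heq : (fun ω => M.jumpTime ω (n + 1)) ⁻¹' Iio t = ⋃ q ∈ D, {ω | (q : ℝ≥0∞) < t ∧
        M.jumpTime ω n < q ∧ M.obs (ω q) ≠ M.obs (ω (M.jumpTime ω n).toNNReal)} := by
      ext ω
      simp only [mem_preimage, mem_Iio, M.jumpTime_succ_lt_iff hD, mem_iUnion, exists_prop]
      rfl
    rw [heq]
    refine MeasurableSet.biUnion hDc fun q _ => ?_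
    refine (MeasurableSet.const _).inter ((measurableSet_lt ih measurable_const).inter ?_)
    have hpair : Measurable fun ω : CadlagPath I => (ω q, ω (M.jumpTime ω n).toNNReal) :=
      (CadlagPath.measurable_eval q).prodMk
        (CadlagPath.measurable_eval_uncurry.comp (measurable_id.prodMk ih.ennreal_toNNReal))
    exact hpair (MeasurableSet.of_discrete (s := {p : I × I | M.obs p.1 ≠ M.obs p.2}))

theorem measurable_jumpCount (t : ℝ≥0) : Measurable fun ω => M.jumpCount ω t := by
  refine measurable_to_countable' fun n => ?_
  have heq : (fun ω => M.jumpCount ω t) ⁻¹' {n} =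
      {ω | M.jumpTime ω n ≤ t ∧ t < M.jumpTime ω (n + 1)} := by
    ext ω
    exact M.jumpCount_eq_iff ω t n
  rw [heq]
  exact (measurableSet_le (M.measurable_jumpTime n) measurable_const).inter
    (measurableSet_lt measurable_const (M.measurable_jumpTime (n + 1)))

theorem measurable_eval_jumpTime (n : ℕ) :
    Measurable fun ω : CadlagPath I => ω (M.jumpTime ω n).toNNReal :=
  CadlagPath.measurable_eval_uncurry.comp
    (measurable_id.prodMk (M.measurable_jumpTime n).ennreal_toNNReal)

end JumpMeasurability

/-! ### Measurability of the filtering process -/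

section FilterMeasurability

variable {I O : Type*} [Fintype I] [TopologicalSpace I] [DiscreteTopology I] [DecidableEq O]
  (M : FilteringModel I O)

theorem coe_postJump_succ_of_lt (μ : stdSimplex ℝ I) (ω : CadlagPath I) {n : ℕ}
    (h : M.jumpTime ω (n + 1) < ⊤) :
    (M.postJump μ ω (n + 1)).1 = M.H (M.Y ω (M.jumpTime ω (n + 1)).toNNReal)
      ((M.flow (M.jumpTime ω (n + 1) - M.jumpTime ω n).toNNReal (M.postJump μ ω n)).1
        ᵥ* M.rate) := by
  rw [postJump, postJumpAux, dif_pos h]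
  rfl

theorem postJump_succ_of_not_lt (μ : stdSimplex ℝ I) (ω : CadlagPath I) {n : ℕ}
    (h : ¬ M.jumpTime ω (n + 1) < ⊤) : M.postJump μ ω (n + 1) = M.postJump μ ω n := by
  rw [postJump, postJumpAux, dif_neg h]
  rfl

/-- After time `0` the recursion for the filtering process involves only the observed path. Hence the
filtering process depends on the initial distribution only through its
initial value. -/
theorem filterPath_congr {μ ν : stdSimplex ℝ I} {ω : CadlagPath I}
    (h : M.condProb (M.Y ω 0) μ = M.condProb (M.Y ω 0) ν) :
    M.filterPath μ ω = M.filterPath ν ω := by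
  have hpost : ∀ n, M.postJump μ ω n = M.postJump ν ω n := by
    intro n
    induction n with
    | zero => exact h
    | succ n ih =>
      by_cases hT : M.jumpTime ω (n + 1) < ⊤
      · apply Subtype.ext
        rw [coe_postJump_succ_of_lt _ _ _ hT, coe_postJump_succ_of_lt _ _ _ hT, ih]
      · rw [postJump_succ_of_not_lt _ _ _ hT, postJump_succ_of_not_lt _ _ _ hT, ih]
  apply Subtype.ext
  funext t
  simp only [filterPath, filterValue, hpost]

variable [MeasurableSpace I] [DiscreteMeasurableSpace I] [Finite O]

theorem measurable_postJump (μ : stdSimplex ℝ I) (n : ℕ) :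
    Measurable fun ω => M.postJump μ ω n := by
  induction n with
  | zero =>
    exact (Measurable.of_discrete (f := fun i => M.condProb (M.obs i) μ)).comp
      (CadlagPath.measurable_eval 0)
  | succ n ih =>
    have hflow : Measurable fun ω =>
        (M.flow (M.jumpTime ω (n + 1) - M.jumpTime ω n).toNNReal (M.postJump μ ω n)).1 ᵥ* M.rate :=
      (Continuous.matrix_vecMul continuous_id continuous_const).measurable.comp
        (measurable_subtype_coe.comp (M.measurable_flow_uncurry.comp
          (((M.measurable_jumpTime (n + 1)).sub (M.measurable_jumpTime n)).ennreal_toNNReal.prodMk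
            ih)))
    have hH : Measurable fun p : I × (I → ℝ) => M.H (M.obs p.1) p.2 :=
      measurable_from_prod_countable_right fun i => M.measurable_H (M.obs i)
    have hval := hH.comp ((M.measurable_eval_jumpTime (n + 1)).prodMk hflow)
    refine (MeasurableEmbedding.subtype_coe M.measurableSet_effSimplex).measurable_comp_iff.1 ?_
    classical
    have heq : (Subtype.val ∘ fun ω => M.postJump μ ω (n + 1)) = fun ω =>
        if M.jumpTime ω (n + 1) < ⊤ then M.H (M.obs (ω (M.jumpTime ω (n + 1)).toNNReal))
          ((M.flow (M.jumpTime ω (n + 1) - M.jumpTime ω n).toNNReal (M.postJump μ ω n)).1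
            ᵥ* M.rate)
        else (M.postJump μ ω n).1 := by
      funext ω
      split_ifs with hT
      · exact M.coe_postJump_succ_of_lt μ ω hT
      · exact congrArg Subtype.val (M.postJump_succ_of_not_lt μ ω hT)
    rw [heq]
    exact Measurable.ite (measurableSet_lt (M.measurable_jumpTime (n + 1)) measurable_const)
      hval (measurable_subtype_coe.comp ih)

theorem measurable_filterPath (μ : stdSimplex ℝ I) : Measurable (M.filterPath μ) := by
  refine CadlagPath.measurable_iff_eval.2 fun t => ?_
  set g : ℕ × CadlagPath I → M.effSimplex := fun p =>
    M.flow (t - (M.jumpTime p.2 p.1).toNNReal) (M.postJump μ p.2 p.1) with hg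
  have h : Measurable g := by
    refine measurable_from_prod_countable_right fun n => ?_
    have hn : Measurable fun ω : CadlagPath I =>
        (t - (M.jumpTime ω n).toNNReal, M.postJump μ ω n) :=
      ((M.measurable_jumpTime n).ennreal_toNNReal.const_sub t).prodMk (M.measurable_postJump μ n)
    exact M.measurable_flow_uncurry.comp hn
  have heq : (fun ω => M.filterPath μ ω t) = fun ω => g (M.jumpCount ω t, ω) := rfl
  rw [heq]
  exact h.comp ((M.measurable_jumpCount t).prodMk measurable_id)

end FilterMeasurability

end FilteringModel

/-! ### The mixture over the initial observation -/

namespace FilteringModel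

section Conditioning

variable {I O : Type*} [Fintype I] [DecidableEq O] (M : FilteringModel I O)

theorem condProb_mem_face (a : O) (μ : stdSimplex ℝ I) : (M.condProb a μ).1 ∈ M.face a :=
  M.H_mem_face a fun i _ => μ.2.1 i

theorem condProb_injective (μ : stdSimplex ℝ I) : Function.Injective fun a => M.condProb a μ :=
  fun a b h => M.face_disjoint (M.condProb_mem_face a μ) (by
    rw [show M.condProb a μ = M.condProb b μ from h]
    exact M.condProb_mem_face b μ)

theorem H_eq_self {a : O} {x : I → ℝ} (hx : x ∈ M.face a) : M.H a x = x := by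
  have hsum : ∑ j with M.obs j = a, x j = 1 := by
    rw [Finset.sum_filter, ← hx.1.2]
    refine Finset.sum_congr rfl fun j _ => ?_
    split_ifs with hj
    · rfl
    · exact (hx.2 j hj).symm
  funext i
  by_cases hi : M.obs i = a
  · simp [H, hi, hsum]
  · simp [H, hi, hx.2 i hi]

theorem condProb_effToSimplex_condProb (a : O) (μ : stdSimplex ℝ I) :
    M.condProb a (M.effToSimplex (M.condProb a μ)) = M.condProb a μ :=
  Subtype.ext (M.H_eq_self (M.condProb_mem_face a μ))

variable [Fintype O]

/-- The law of total probability `μ = ∑ₐ μ(h⁻¹(a)) H_a[μ]`. -/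
theorem sum_mul_H (μ : stdSimplex ℝ I) (i : I) :
    μ.1 i = ∑ a, (∑ j with M.obs j = a, μ.1 j) * M.H a μ.1 i := by
  rw [Finset.sum_eq_single (M.obs i)]
  · by_cases h0 : ∑ j with M.obs j = M.obs i, μ.1 j = 0
    · rw [h0, zero_mul]
      -- a fibre of zero mass: `H_a[μ]` is the reference probability, which gets weight `0`
      exact (Finset.sum_eq_zero_iff_of_nonneg fun j _ => μ.2.1 j).1 h0 i (by simp)
    · simp only [H, ne_eq, not_true_eq_false, if_false, h0, not_false_eq_true, if_true]
      field_simp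
  · intro a _ ha
    simp [H, ha.symm]
  · simp

theorem isProbabilityMeasure_initialLaw (μ : stdSimplex ℝ I) :
    IsProbabilityMeasure (M.initialLaw μ) := by
  constructor
  rw [initialLaw, Measure.finsetSum_apply]
  simp only [Measure.smul_apply, measure_univ, smul_eq_mul, mul_one]
  have hnonneg : ∀ a : O, 0 ≤ ∑ i with M.obs i = a, μ i :=
    fun a => Finset.sum_nonneg fun i _ => μ.2.1 i
  rw [← ENNReal.ofReal_sum_of_nonneg fun a _ => hnonneg a, Finset.sum_fiberwise,
    ← ENNReal.ofReal_one]
  exact congrArg ENNReal.ofReal μ.2.2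

theorem initialLaw_singleton (μ : stdSimplex ℝ I) (a : O) :
    M.initialLaw μ {M.condProb a μ} = ENNReal.ofReal (∑ i with M.obs i = a, μ i) := by
  rw [initialLaw, Measure.finsetSum_apply, Finset.sum_eq_single a]
  · simp
  · intro b _ hb
    have : M.condProb b μ ≠ M.condProb a μ := fun h => hb (M.condProb_injective μ h)
    simp [this]
  · simp

end Conditioning

section Mixture

variable {I O : Type*} [Fintype I] [TopologicalSpace I] [MeasurableSpace I]

/-- The law `Q` has finite support, so that `Q.bind` is the finite mixture whether or not
`M.pdpLaw P` is measurable. -/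
theorem pdpLawOfInitial_initialLaw [Fintype O] [DiscreteTopology I] [DecidableEq O]
    (M : FilteringModel I O) (P : stdSimplex ℝ I → Measure (CadlagPath I))
    (μ : stdSimplex ℝ I) : M.pdpLawOfInitial P (M.initialLaw μ) =
      ∑ a, ENNReal.ofReal (∑ i with M.obs i = a, μ i) • M.pdpLaw P (M.condProb a μ) := by
  have hae : AEMeasurable (M.pdpLaw P) (M.initialLaw μ) := by
    rw [initialLaw, ← Measure.sum_fintype]
    exact AEMeasurable.sum_measure fun a => aemeasurable_dirac.smul_measure _
  ext Γ hΓ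
  rw [pdpLawOfInitial, Measure.bind_apply hΓ hae, initialLaw, lintegral_finsetSum_measure,
    Measure.finsetSum_apply]
  refine Finset.sum_congr rfl fun a _ => ?_
  rw [lintegral_smul_measure, lintegral_dirac, Measure.smul_apply]

variable [DecidableEq I]

/-- Under a Markov law started in the face of `a`, the observation starts at `a` almost surely. -/
theorem IsMarkovLaw.ae_Y_zero_eq {M : FilteringModel I O} {a : O} {ν : stdSimplex ℝ I}
    {P : Measure (CadlagPath I)} (hP : M.IsMarkovLaw ν P) (hν : ν.1 ∈ M.face a) :
    ∀ᵐ ω ∂P, M.Y ω 0 = a := by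
  have h : ∀ᵐ ω ∂P, ∀ i, M.obs i ≠ a → ω 0 ≠ i := by
    refine ae_all_iff.2 fun i => ?_
    by_cases hi : M.obs i = a
    · exact Eventually.of_forall fun _ h => absurd hi h
    · have h0 : P {ω | ω 0 = i} = 0 := by
        rw [hP.initial i]
        exact ENNReal.ofReal_eq_zero.2 (hν.2 i hi).le
      filter_upwards [measure_eq_zero_iff_ae_notMem.1 h0] with ω hω _ using hω
  filter_upwards [h] with ω hω
  by_contra hne
  exact hω (ω 0) hne rfl

variable [DiscreteTopology I] [DecidableEq O] (M : FilteringModel I O)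

theorem map_filterPath_condProb {P : stdSimplex ℝ I → Measure (CadlagPath I)}
    (hP : ∀ μ, M.IsMarkovLaw μ (P μ)) (μ : stdSimplex ℝ I) (a : O) :
    (P (M.effToSimplex (M.condProb a μ))).map (M.filterPath μ) = M.pdpLaw P (M.condProb a μ) := by
  refine Measure.map_congr ?_
  filter_upwards [(hP (M.effToSimplex (M.condProb a μ))).ae_Y_zero_eq (a := a)
    (M.condProb_mem_face a μ)] with ω hω
  refine M.filterPath_congr ?_
  rw [hω, condProb_effToSimplex_condProb]

end Mixture

end FilteringModel

theorem proposition4 {I O : Type*} [Fintype I] [DecidableEq I] [TopologicalSpace I]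
    [DiscreteTopology I] [MeasurableSpace I] [DiscreteMeasurableSpace I] [Fintype O] [DecidableEq O]
    (M : FilteringModel I O) (P : stdSimplex ℝ I → Measure (CadlagPath I))
    (hP : ∀ μ, M.IsMarkovLaw μ (P μ)) (μ : stdSimplex ℝ I) :
    Measurable (M.filterPath μ) ∧
      IsProbabilityMeasure (M.initialLaw μ) ∧
      (∀ a, M.initialLaw μ {M.condProb a μ} =
        ENNReal.ofReal (∑ i with M.obs i = a, μ i)) ∧
      (P μ).map (M.filterPath μ) = M.pdpLawOfInitial P (M.initialLaw μ) := by
  have hmeas := M.measurable_filterPath μ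
  refine ⟨hmeas, M.isProbabilityMeasure_initialLaw μ, M.initialLaw_singleton μ, ?_⟩
  have hmix := (hP μ).eq_sum (fun a => ∑ i with M.obs i = a, μ i)
    (fun a => Finset.sum_nonneg fun i _ => μ.2.1 i) (fun a => M.effToSimplex (M.condProb a μ))
    (fun a => hP _) (M.sum_mul_H μ)
  rw [M.pdpLawOfInitial_initialLaw P μ, hmix]
  ext Γ hΓ
  rw [Measure.map_apply hmeas hΓ, Measure.finsetSum_apply, Measure.finsetSum_apply]
  refine Finset.sum_congr rfl fun a _ => ?_
  rw [Measure.smul_apply, Measure.smul_apply, ← M.map_filterPath_condProb hP μ a,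
    Measure.map_apply hmeas hΓ]
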